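/- **Theorem 4.2 (the quasiclassical limit is a Poisson vertex algebra).** Let $\mathbb F$ be a field of characteristic $0$. A *vertex algebra* over a commutative ring $R$ is an $R$-module $V$ with an $R$-bilinear product $a\otimes b\mapsto a(z)b=\sum_{n\in\mathbb Z}(a_{(n)}b)z^{-n-1}\in V((z))$, an $R$-linear operator $T$ and a non-zero vector $|0\rangle$ such that, for all $a,b\in V$: $T(a(z)b)=(Ta)(z)b+a(z)Tb$; $(Ta)(z)=\partial_z a(z)$; $|0\rangle(z)a=a$; $a(z)|0\rangle\in a+zV[[z]]$; and $(z-w)^{N}a(z)b(w)=(z-w)^{N}b(w)a(z)$ for some $N\in\mathbb Z_{\ge 0}$ depending on $a,b$. If $R\supseteq\mathbb Q$, put $:\!ab\!:\;=a_{(-1)}b$ and $[a_\lambda b]=\sum_{j\ge 0}\frac{\lambda^j}{j!}a_{(j)}b\in V[\lambda]$. Let $V_\hbar$ be a vertex algebra over $\mathbb F[[\hbar]]$ such that (i) $\hbar v=0$ implies $v=0$ for $v\in V_\hbar$, and (ii) $[a_\lambda b]\in\hbar V_\hbar[\lambda]$ for all $a,b\in V_\hbar$. On the $\mathbb F$-vector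 space $\mathcal V=V_\hbar/\hbar V_\hbar$ let $1$ be the image of $|0\rangle$, let $\partial$ be the operator induced by $T$, let $\cdot$ be the product induced by $:\ :$, and let $\{a_\lambda b\}\in\mathcal V[\lambda]$ be the image of $[\tilde a_\lambda\tilde b]'$, where $\tilde a,\tilde b\in V_\hbar$ are preimages of $a,b$ and $[\tilde a_\lambda\tilde b]'\in V_\hbar[\lambda]$ is the unique element with $[\tilde a_\lambda\tilde b]=\hbar[\tilde a_\lambda\tilde b]'$. (These are well defined.) Then the quasiclassical limit $(\mathcal V,1,\partial,\cdot,\{\cdot_\lambda\cdot\})$ is a Poisson vertex algebra over $\mathbb F$, that is, for all $a,b,c\in\mathcal V$: * (A) $(\mathcal V,\partial,\{\cdot_\lambda\cdot\})$ is a Lie conformal algebra: the bracket is $\mathbb F$-bilinear, $\{\partial a_\lambda b\}=-\lambda\{a_\lambda b\}$, $\{a_\lambda\partial b\}=(\lambda+\partial)\{a_\lambda b\}$, $\{b_\lambda a\}=-\{a_{-\lambda-\partial}b\}$ (powers of $-\lambda-\partial$ acting on the coefficients from the left), and $\{a_\lambda\{b_\mu c\}\}=\{\{a_\lambda b\}_{\lambda+\mu}c\}+\{b_\mu\{a_\lambda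 c\}\}$ in $\mathcal V[\lambda,\mu]$; * (B) $(\mathcal V,1,\partial,\cdot)$ is a commutative associative unital algebra with derivation $\partial$ (the zero algebra is allowed); * (C) $\{a_\lambda bc\}=\{a_\lambda b\}c+b\{a_\lambda c\}$. -/

import Mathlib

open scoped PowerSeries

noncomputable section

/-! ### Vertex algebras over a commutative ring -/

/-- Multiplication by `z - w` on formal distributions in two variables. A distribution
`∑ f m n z ^ (-m-1) w ^ (-n-1)`, summed over all integers `m`, `n`, with coefficients in `U`, is
represented by its coefficients. -/
def mulZSubW {U : Type*} [AddCommGroup U] (f : ℤ → ℤ → U) : ℤ → ℤ → U :=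
  fun m n => f (m + 1) n - f m (n + 1)

/-- A vertex algebra over a commutative ring `R`, that is, a local unital `z`-algebra.
The product `a(z)b ∈ V((z))` is `Y a b`, and `VertexOperator.ncoeff (Y a) n` is the operator
`a_(n)` in `a(z) = ∑ a_(n) z ^ (-n-1)`. -/
structure VertexAlgebra (R V : Type*) [CommRing R] [AddCommGroup V] [Module R V] where
  /-- the `z`-product `a ↦ a(z)`, where `a(z) : V → V((z))` -/
  Y : V →ₗ[R] VertexOperator R V
  /-- the translation operator -/
  T : V →ₗ[R] V
  /-- the unit element (vacuum vector) -/
  vac : V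
  /-- `T (a(z)b) = (Ta)(z)b + a(z)(Tb)` -/
  T_derivation : ∀ (a b : V) (n : ℤ),
    T (VertexOperator.ncoeff (Y a) n b) =
      VertexOperator.ncoeff (Y (T a)) n b + VertexOperator.ncoeff (Y a) n (T b)
  /-- `(Ta)(z) = ∂_z a(z)`, that is, `(Ta)_(n) = -n a_(n-1)` -/
  Y_T : ∀ (a b : V) (n : ℤ),
    VertexOperator.ncoeff (Y (T a)) n b = -(n • VertexOperator.ncoeff (Y a) (n - 1) b)
  vac_ne_zero : vac ≠ 0
  /-- `1(z)a = a` -/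
  vac_Y : ∀ (a : V) (n : ℤ), VertexOperator.ncoeff (Y vac) n a = if n = -1 then a else 0
  /-- `a(z)1 = a` modulo `zV[[z]]` -/
  Y_vac : ∀ (a : V) (n : ℤ), -1 ≤ n →
    VertexOperator.ncoeff (Y a) n vac = if n = -1 then a else 0
  /-- `(z - w) ^ N a(z)b(w) = (z - w) ^ N b(w)a(z)` for some `N` depending on `a`, `b` -/
  locality : ∀ a b : V, ∃ N : ℕ,
    mulZSubW^[N] (fun m n : ℤ =>
        VertexOperator.ncoeff (Y a) m ∘ₗ VertexOperator.ncoeff (Y b) n) =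
      mulZSubW^[N] (fun m n : ℤ =>
        VertexOperator.ncoeff (Y b) n ∘ₗ VertexOperator.ncoeff (Y a) m)

namespace VertexAlgebra

variable {R V : Type*} [CommRing R] [AddCommGroup V] [Module R V]

/-- The `n`-th product `a_(n)b`. -/
def nProd (A : VertexAlgebra R V) (n : ℤ) (a b : V) : V :=
  VertexOperator.ncoeff (A.Y a) n b

/-- The normally ordered product `:ab: = a_(-1)b`. -/
def normalProd (A : VertexAlgebra R V) (a b : V) : V := A.nProd (-1) a b

theorem nProd_add_left (A : VertexAlgebra R V) (n : ℤ) (a a' b : V) :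
    A.nProd n (a + a') b = A.nProd n a b + A.nProd n a' b := by
  simp [nProd]

theorem nProd_add_right (A : VertexAlgebra R V) (n : ℤ) (a b b' : V) :
    A.nProd n a (b + b') = A.nProd n a b + A.nProd n a b' := by
  simp only [nProd, map_add]

theorem nProd_smul_left (A : VertexAlgebra R V) (n : ℤ) (r : R) (a b : V) :
    A.nProd n (r • a) b = r • A.nProd n a b := by
  simp [nProd]

theorem nProd_smul_right (A : VertexAlgebra R V) (n : ℤ) (r : R) (a b : V) :
    A.nProd n a (r • b) = r • A.nProd n a b := by
  simp only [nProd, map_smul]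

theorem finite_support_nProd (A : VertexAlgebra R V) (c : ℕ → R) (a b : V) :
    (Function.support fun j : ℕ => c j • A.nProd j a b).Finite := by
  refine (Set.finite_Iio
    (-(HahnSeries.order ((HahnModule.of R).symm (A.Y a b)))).toNat).subset ?_
  intro j hj
  by_contra h
  refine hj ?_
  have h0 : A.nProd j a b = 0 := by
    refine VertexOperator.ncoeff_eq_zero_of_lt_order (A.Y a) j b ?_
    simp only [Set.mem_Iio, not_lt, Int.toNat_le] at h
    omega
  simp [h0]

/-- The `λ`-bracket `[a_λ b] = ∑_{j ≥ 0} (λ ^ j / j!) a_(j)b`, an element of `V[λ]`. -/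
def lambdaBracket [Algebra ℚ R] (A : VertexAlgebra R V) (a b : V) : PolynomialModule R V :=
  PolynomialModule.ofCoeff R (Finsupp.ofSupportFinite
    (fun j : ℕ => algebraMap ℚ R ((j.factorial : ℚ)⁻¹) • A.nProd j a b)
    (A.finite_support_nProd (fun j => algebraMap ℚ R ((j.factorial : ℚ)⁻¹)) a b))

theorem coeff_lambdaBracket [Algebra ℚ R] (A : VertexAlgebra R V) (a b : V) (j : ℕ) :
    (A.lambdaBracket a b).coeff j = algebraMap ℚ R ((j.factorial : ℚ)⁻¹) • A.nProd j a b :=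
  rfl

end VertexAlgebra

/-! ### Lie conformal algebras and Poisson vertex algebras -/

section Polynomials

variable {F V M : Type*} [Field F] [AddCommGroup V] [Module F V] [AddCommGroup M] [Module F M]

/-- The substitution `V[λ] → M`, `∑ λ ^ n v_n ↦ ∑ D ^ n (φ v_n)`. -/
def substVar (φ : V →ₗ[F] M) (D : M →ₗ[F] M) : PolynomialModule F V →ₗ[F] M :=
  (Finsupp.lsum F fun n : ℕ => (D ^ n) ∘ₗ φ) ∘ₗ
    (PolynomialModule.coeffLinearEquiv F F).toLinearMap

variable (F V) in
/-- Multiplication by the variable on `V[λ]`. -/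
def mulVar : PolynomialModule F V →ₗ[F] PolynomialModule F V :=
  Algebra.lsmul F F (PolynomialModule F V) (Polynomial.X : Polynomial F)

variable (F V) in
/-- The space `V[λ, μ] = (V[λ])[μ]`. -/
abbrev Poly₂ : Type _ := PolynomialModule F (PolynomialModule F V)

variable (F V) in
/-- Multiplication by `λ` on `V[λ, μ]`. -/
def mulLambda : Poly₂ F V →ₗ[F] Poly₂ F V := PolynomialModule.map F (mulVar F V)

variable (F V) in
/-- Multiplication by `μ` on `V[λ, μ]`. -/
def mulMu : Poly₂ F V →ₗ[F] Poly₂ F V := mulVar F (PolynomialModule F V)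

variable (F V) in
/-- The inclusion `V[λ] → V[λ, μ]`. -/
def inclLambda : PolynomialModule F V →ₗ[F] Poly₂ F V := PolynomialModule.lsingle F 0

variable (F V) in
/-- The map `V[λ] → V[λ, μ]` that renames the variable `λ` to `μ`. -/
def inclMu : PolynomialModule F V →ₗ[F] Poly₂ F V :=
  PolynomialModule.map F (PolynomialModule.lsingle F 0)

/-- The substitution `∑ λ ^ n v_n ↦ ∑ (-λ-∂) ^ n v_n` on `V[λ]`; it sends `{a_λ b}` to
`{a_(-λ-∂) b}`. -/
def substSkew (del : V →ₗ[F] V) : PolynomialModule F V →ₗ[F] PolynomialModule F V :=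
  substVar (PolynomialModule.lsingle F 0) (-mulVar F V - PolynomialModule.map F del)

variable (br : V →ₗ[F] V →ₗ[F] PolynomialModule F V)

/-- `{a_λ p(μ)}` in `V[λ, μ]`, for a polynomial `p(μ)` with coefficients in `V`. -/
def bracketLambda (a : V) : PolynomialModule F V →ₗ[F] Poly₂ F V :=
  substVar (inclLambda F V ∘ₗ br a) (mulMu F V)

/-- `{b_μ p(λ)}` in `V[λ, μ]`, for a polynomial `p(λ)` with coefficients in `V`. -/
def bracketMu (b : V) : PolynomialModule F V →ₗ[F] Poly₂ F V :=
  substVar (inclMu F V ∘ₗ br b) (mulLambda F V)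

/-- `{p(λ)_(λ+μ) c}` in `V[λ, μ]`, for a polynomial `p(λ)` with coefficients in `V`. -/
def bracketLambdaAddMu (c : V) : PolynomialModule F V →ₗ[F] Poly₂ F V :=
  substVar
    (substVar (inclLambda F V ∘ₗ PolynomialModule.lsingle F 0) (mulLambda F V + mulMu F V) ∘ₗ
      br.flip c)
    (mulLambda F V)

/-- The axioms of a Lie conformal algebra for a vector space `V` with an endomorphism `∂`
and a bilinear `λ`-bracket with values in `V[λ]`. -/
structure IsLieConformalAlgebra (del : V →ₗ[F] V)
    (br : V →ₗ[F] V →ₗ[F] PolynomialModule F V) : Prop where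
  /-- `{∂a_λ b} = -λ{a_λ b}` -/
  sesquilinear_left : ∀ a b : V, br (del a) b = -mulVar F V (br a b)
  /-- `{a_λ ∂b} = (λ + ∂){a_λ b}` -/
  sesquilinear_right : ∀ a b : V,
    br a (del b) = mulVar F V (br a b) + PolynomialModule.map F del (br a b)
  /-- `{b_λ a} = -{a_(-λ-∂) b}` -/
  skewsymmetry : ∀ a b : V, br b a = -substSkew del (br a b)
  /-- `{a_λ {b_μ c}} = {{a_λ b}_(λ+μ) c} + {b_μ {a_λ c}}` -/
  jacobi : ∀ a b c : V,
    bracketLambda br a (br b c) = bracketLambdaAddMu br c (br a b) + bracketMu br b (br a c)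

end Polynomials

/-- The axioms of a commutative associative unital differential algebra over `F`. -/
structure IsCommDifferentialAlgebra {F V : Type*} [Field F] [AddCommGroup V] [Module F V]
    (one : V) (del : V →ₗ[F] V) (mul : V →ₗ[F] V →ₗ[F] V) : Prop where
  mul_comm : ∀ a b : V, mul a b = mul b a
  mul_assoc : ∀ a b c : V, mul (mul a b) c = mul a (mul b c)
  one_mul : ∀ a : V, mul one a = a
  del_mul : ∀ a b : V, del (mul a b) = mul (del a) b + mul a (del b)

/-- A quintuple consisting of a vector space `V` over `F`, a vector `1`, an endomorphism `∂`,
a bilinear product and a bilinear `λ`-bracket with values in `V[λ]`; no axioms are imposed. -/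
structure PoissonQuintuple (F V : Type*) [Field F] [AddCommGroup V] [Module F V] where
  one : V
  del : V →ₗ[F] V
  mul : V →ₗ[F] V →ₗ[F] V
  bracket : V →ₗ[F] V →ₗ[F] PolynomialModule F V

/-- The axioms of a Poisson vertex algebra. -/
structure PoissonQuintuple.IsPoissonVertexAlgebra {F V : Type*} [Field F] [AddCommGroup V]
    [Module F V] (P : PoissonQuintuple F V) : Prop where
  lieConformal : IsLieConformalAlgebra P.del P.bracket
  commDifferential : IsCommDifferentialAlgebra P.one P.del P.mul
  /-- left Leibniz rule `{a_λ bc} = {a_λ b}c + b{a_λ c}` -/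
  leibniz : ∀ a b c : V,
    P.bracket a (P.mul b c) =
      PolynomialModule.map F (P.mul.flip c) (P.bracket a b) +
        PolynomialModule.map F (P.mul b) (P.bracket a c)

/-! ### The quasiclassical limit -/

namespace QuasiclassicalLimit

variable {F V : Type*} [Field F] [AddCommGroup V] [Module F⟦X⟧ V]

variable (F V) in
/-- The submodule `ħV` of a module `V` over `F[[ħ]]`. -/
def hbarSubmodule : Submodule F⟦X⟧ V :=
  LinearMap.range (LinearMap.lsmul F⟦X⟧ V (PowerSeries.X : F⟦X⟧))

variable (F V) in
/-- The space `V/ħV`. -/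
abbrev Carrier : Type _ := V ⧸ hbarSubmodule F V

variable (F) in
/-- The projection `V → V/ħV`. -/
def proj : V →ₗ[F⟦X⟧] Carrier F V := (hbarSubmodule F V).mkQ

/-- A preimage in `V` of an element of `V/ħV`. -/
def lift (a : Carrier F V) : V := Function.surjInv (hbarSubmodule F V).mkQ_surjective a

theorem proj_lift (a : Carrier F V) : proj F (lift a) = a :=
  Function.surjInv_eq (hbarSubmodule F V).mkQ_surjective a

theorem proj_hbar_smul (v : V) : proj F ((PowerSeries.X : F⟦X⟧) • v) = 0 :=
  (Submodule.Quotient.mk_eq_zero _).2 ⟨v, rfl⟩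

theorem exists_of_proj_eq {v w : V} (h : proj F v = proj F w) :
    ∃ u : V, v = w + (PowerSeries.X : F⟦X⟧) • u := by
  obtain ⟨u, hu⟩ := (Submodule.Quotient.eq (hbarSubmodule F V)).1 h
  exact ⟨u, by rw [show (PowerSeries.X : F⟦X⟧) • u = v - w from hu]; abel⟩

theorem proj_normalProd_congr (A : VertexAlgebra F⟦X⟧ V) {a a' b b' : V}
    (ha : proj F a = proj F a') (hb : proj F b = proj F b') :
    proj F (A.normalProd a b) = proj F (A.normalProd a' b') := by
  obtain ⟨u, rfl⟩ := exists_of_proj_eq ha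
  obtain ⟨v, rfl⟩ := exists_of_proj_eq hb
  simp only [VertexAlgebra.normalProd, A.nProd_add_left, A.nProd_add_right, A.nProd_smul_left,
    A.nProd_smul_right, map_add, proj_hbar_smul, add_zero]

theorem hbar_smul_injective (htf : ∀ v : V, (PowerSeries.X : F⟦X⟧) • v = 0 → v = 0) {v w : V}
    (h : (PowerSeries.X : F⟦X⟧) • v = (PowerSeries.X : F⟦X⟧) • w) : v = w :=
  sub_eq_zero.1 (htf _ (by rw [smul_sub, h, sub_self]))

section

variable [CharZero F]

/-- Given `[a_λ b] ∈ ħV[λ]`, the polynomial `[a_λ b]'` with `[a_λ b] = ħ[a_λ b]'`. -/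
def divBracket (A : VertexAlgebra F⟦X⟧ V)
    (hbr : ∀ a b : V, ∃ p : PolynomialModule F⟦X⟧ V,
      A.lambdaBracket a b = (PowerSeries.X : F⟦X⟧) • p) (a b : V) : PolynomialModule F⟦X⟧ V :=
  (hbr a b).choose

theorem hbar_smul_divBracket (A : VertexAlgebra F⟦X⟧ V)
    (hbr : ∀ a b : V, ∃ p : PolynomialModule F⟦X⟧ V,
      A.lambdaBracket a b = (PowerSeries.X : F⟦X⟧) • p) (a b : V) (j : ℕ) :
    (PowerSeries.X : F⟦X⟧) • (divBracket A hbr a b).coeff j = (A.lambdaBracket a b).coeff j := by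
  rw [(hbr a b).choose_spec]; rfl

variable (A : VertexAlgebra F⟦X⟧ V)
  (hbr : ∀ a b : V, ∃ p : PolynomialModule F⟦X⟧ V,
    A.lambdaBracket a b = (PowerSeries.X : F⟦X⟧) • p)

theorem divBracket_add_left (htf : ∀ v : V, (PowerSeries.X : F⟦X⟧) • v = 0 → v = 0)
    (a a' b : V) (j : ℕ) :
    (divBracket A hbr (a + a') b).coeff j =
      (divBracket A hbr a b).coeff j + (divBracket A hbr a' b).coeff j := by
  apply hbar_smul_injective htf
  simp only [smul_add, hbar_smul_divBracket, VertexAlgebra.coeff_lambdaBracket,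
    A.nProd_add_left]

theorem divBracket_add_right (htf : ∀ v : V, (PowerSeries.X : F⟦X⟧) • v = 0 → v = 0)
    (a b b' : V) (j : ℕ) :
    (divBracket A hbr a (b + b')).coeff j =
      (divBracket A hbr a b).coeff j + (divBracket A hbr a b').coeff j := by
  apply hbar_smul_injective htf
  simp only [smul_add, hbar_smul_divBracket, VertexAlgebra.coeff_lambdaBracket,
    A.nProd_add_right]

theorem divBracket_smul_left (htf : ∀ v : V, (PowerSeries.X : F⟦X⟧) • v = 0 → v = 0)
    (r : F⟦X⟧) (a b : V) (j : ℕ) :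
    (divBracket A hbr (r • a) b).coeff j = r • (divBracket A hbr a b).coeff j := by
  apply hbar_smul_injective htf
  rw [smul_comm _ r]
  simp only [hbar_smul_divBracket, VertexAlgebra.coeff_lambdaBracket, A.nProd_smul_left]
  rw [smul_comm]

theorem divBracket_smul_right (htf : ∀ v : V, (PowerSeries.X : F⟦X⟧) • v = 0 → v = 0)
    (r : F⟦X⟧) (a b : V) (j : ℕ) :
    (divBracket A hbr a (r • b)).coeff j = r • (divBracket A hbr a b).coeff j := by
  apply hbar_smul_injective htf
  rw [smul_comm _ r]
  simp only [hbar_smul_divBracket, VertexAlgebra.coeff_lambdaBracket, A.nProd_smul_right]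
  rw [smul_comm]

theorem proj_divBracket_congr (htf : ∀ v : V, (PowerSeries.X : F⟦X⟧) • v = 0 → v = 0)
    {a a' b b' : V} (ha : proj F a = proj F a') (hb : proj F b = proj F b') (j : ℕ) :
    proj F ((divBracket A hbr a b).coeff j) = proj F ((divBracket A hbr a' b').coeff j) := by
  obtain ⟨u, rfl⟩ := exists_of_proj_eq ha
  obtain ⟨v, rfl⟩ := exists_of_proj_eq hb
  simp only [divBracket_add_left A hbr htf, divBracket_add_right A hbr htf,
    divBracket_smul_left A hbr htf, divBracket_smul_right A hbr htf, map_add, proj_hbar_smul,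
    add_zero]

end

variable [Module F V] [IsScalarTower F F⟦X⟧ V]

theorem proj_smul (r : F) (v : V) : proj F (r • v) = r • proj F v := rfl

theorem divBracket_smul_left' [CharZero F] (A : VertexAlgebra F⟦X⟧ V)
    (hbr : ∀ a b : V, ∃ p : PolynomialModule F⟦X⟧ V,
      A.lambdaBracket a b = (PowerSeries.X : F⟦X⟧) • p)
    (htf : ∀ v : V, (PowerSeries.X : F⟦X⟧) • v = 0 → v = 0)
    (r : F) (a b : V) (j : ℕ) :
    (divBracket A hbr (r • a) b).coeff j = r • (divBracket A hbr a b).coeff j := by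
  rw [← algebraMap_smul F⟦X⟧ r a, divBracket_smul_left A hbr htf, algebraMap_smul]

theorem divBracket_smul_right' [CharZero F] (A : VertexAlgebra F⟦X⟧ V)
    (hbr : ∀ a b : V, ∃ p : PolynomialModule F⟦X⟧ V,
      A.lambdaBracket a b = (PowerSeries.X : F⟦X⟧) • p)
    (htf : ∀ v : V, (PowerSeries.X : F⟦X⟧) • v = 0 → v = 0)
    (r : F) (a b : V) (j : ℕ) :
    (divBracket A hbr a (r • b)).coeff j = r • (divBracket A hbr a b).coeff j := by
  rw [← algebraMap_smul F⟦X⟧ r b, divBracket_smul_right A hbr htf, algebraMap_smul]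

/-- The operator induced by `T` on `V/ħV`. -/
def del (A : VertexAlgebra F⟦X⟧ V) : Carrier F V →ₗ[F] Carrier F V :=
  ((hbarSubmodule F V).mapQ (hbarSubmodule F V) A.T (by
    rintro _ ⟨v, rfl⟩
    exact ⟨A.T v, by simp⟩)).restrictScalars F

/-- The product on `V/ħV` induced by the normally ordered product: the product of `a` and `b` is
the image of `:ãb̃:`, where `ã`, `b̃` are preimages of `a`, `b`. -/
def mul (A : VertexAlgebra F⟦X⟧ V) : Carrier F V →ₗ[F] Carrier F V →ₗ[F] Carrier F V :=
  LinearMap.mk₂ F (fun a b => proj F (A.normalProd (lift a) (lift b)))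
    (fun a a' b => by
      rw [proj_normalProd_congr A (a' := lift a + lift a') (b' := lift b)
        (by simp [proj_lift]) rfl]
      simp [VertexAlgebra.normalProd, A.nProd_add_left])
    (fun r a b => by
      rw [proj_normalProd_congr A (a' := r • lift a) (b' := lift b)
        (by simp [proj_lift]) rfl]
      rw [← algebraMap_smul F⟦X⟧ r (lift a), VertexAlgebra.normalProd, A.nProd_smul_left,
        algebraMap_smul, proj_smul]
      rfl)
    (fun a b b' => by
      rw [proj_normalProd_congr A (a' := lift a) (b' := lift b + lift b')
        rfl (by simp [proj_lift])]
      simp [VertexAlgebra.normalProd, A.nProd_add_right])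
    (fun r a b => by
      rw [proj_normalProd_congr A (a' := lift a) (b' := r • lift b)
        rfl (by simp [proj_lift])]
      rw [← algebraMap_smul F⟦X⟧ r (lift b), VertexAlgebra.normalProd, A.nProd_smul_right,
        algebraMap_smul, proj_smul]
      rfl)

/-- The map `V[λ] → (V/ħV)[λ]` induced by the projection. -/
def projPoly (p : PolynomialModule F⟦X⟧ V) : PolynomialModule F (Carrier F V) :=
  PolynomialModule.ofCoeff F (p.coeff.mapRange (proj F) (map_zero _))

theorem coeff_projPoly (p : PolynomialModule F⟦X⟧ V) (j : ℕ) :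
    (projPoly p).coeff j = proj F (p.coeff j) := rfl

/-- The `λ`-bracket on `V/ħV`: `{a_λ b}` is the image of `[ã_λ b̃]'`, where `ã`, `b̃` are
preimages of `a`, `b` and `[ã_λ b̃] = ħ[ã_λ b̃]'`. -/
def bracket [CharZero F] (A : VertexAlgebra F⟦X⟧ V)
    (htf : ∀ v : V, (PowerSeries.X : F⟦X⟧) • v = 0 → v = 0)
    (hbr : ∀ a b : V, ∃ p : PolynomialModule F⟦X⟧ V,
      A.lambdaBracket a b = (PowerSeries.X : F⟦X⟧) • p) :
    Carrier F V →ₗ[F] Carrier F V →ₗ[F] PolynomialModule F (Carrier F V) :=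
  LinearMap.mk₂ F (fun a b => projPoly (divBracket A hbr (lift a) (lift b)))
    (fun a a' b => by
      ext j
      change proj F ((divBracket A hbr (lift (a + a')) (lift b)).coeff j) =
        proj F ((divBracket A hbr (lift a) (lift b)).coeff j) +
        proj F ((divBracket A hbr (lift a') (lift b)).coeff j)
      rw [proj_divBracket_congr A hbr htf (a' := lift a + lift a') (b' := lift b)
        (by simp [proj_lift]) rfl, divBracket_add_left A hbr htf, map_add])
    (fun r a b => by
      ext j
      change proj F ((divBracket A hbr (lift (r • a)) (lift b)).coeff j) =
        r • proj F ((divBracket A hbr (lift a) (lift b)).coeff j)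
      rw [proj_divBracket_congr A hbr htf (a' := r • lift a) (b' := lift b)
        (by simp [proj_lift]) rfl, divBracket_smul_left' A hbr htf, proj_smul])
    (fun a b b' => by
      ext j
      change proj F ((divBracket A hbr (lift a) (lift (b + b'))).coeff j) =
        proj F ((divBracket A hbr (lift a) (lift b)).coeff j) +
        proj F ((divBracket A hbr (lift a) (lift b')).coeff j)
      rw [proj_divBracket_congr A hbr htf (a' := lift a) (b' := lift b + lift b')
        rfl (by simp [proj_lift]), divBracket_add_right A hbr htf, map_add])
    (fun r a b => by
      ext j
      change proj F ((divBracket A hbr (lift a) (lift (r • b))).coeff j) =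
        r • proj F ((divBracket A hbr (lift a) (lift b)).coeff j)
      rw [proj_divBracket_congr A hbr htf (a' := lift a) (b' := r • lift b)
        rfl (by simp [proj_lift]), divBracket_smul_right' A hbr htf, proj_smul])

/-- The induced operator is computed on any preimage. -/
theorem del_proj (A : VertexAlgebra F⟦X⟧ V) (a : V) : del A (proj F a) = proj F (A.T a) := rfl

/-- The induced product does not depend on the choice of preimages. -/
theorem mul_proj (A : VertexAlgebra F⟦X⟧ V) (a b : V) :
    mul A (proj F a) (proj F b) = proj F (A.normalProd a b) :=
  proj_normalProd_congr A (proj_lift _) (proj_lift _)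

/-- The induced `λ`-bracket does not depend on the choice of preimages, nor on that of
`[a_λ b]'`. -/
theorem bracket_proj [CharZero F] (A : VertexAlgebra F⟦X⟧ V)
    (htf : ∀ v : V, (PowerSeries.X : F⟦X⟧) • v = 0 → v = 0)
    (hbr : ∀ a b : V, ∃ p : PolynomialModule F⟦X⟧ V,
      A.lambdaBracket a b = (PowerSeries.X : F⟦X⟧) • p)
    (a b : V) (p : PolynomialModule F⟦X⟧ V)
    (hp : A.lambdaBracket a b = (PowerSeries.X : F⟦X⟧) • p) :
    bracket A htf hbr (proj F a) (proj F b) = projPoly p := by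
  ext j
  refine (proj_divBracket_congr A hbr htf (proj_lift _) (proj_lift _) j).trans ?_
  rw [coeff_projPoly]
  congr 1
  apply hbar_smul_injective htf
  rw [hbar_smul_divBracket, hp]
  rfl

end QuasiclassicalLimit

/-- The quasiclassical limit `(V/ħV, 1, ∂, ·, {·_λ ·})` of a vertex algebra `V` over `F[[ħ]]` that
has no `ħ`-torsion and whose `λ`-brackets lie in `ħV[λ]`. -/
def quasiclassicalLimit {F V : Type*} [Field F] [CharZero F] [AddCommGroup V] [Module F⟦X⟧ V]
    [Module F V] [IsScalarTower F F⟦X⟧ V] (A : VertexAlgebra F⟦X⟧ V)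
    (htf : ∀ v : V, (PowerSeries.X : F⟦X⟧) • v = 0 → v = 0)
    (hbr : ∀ a b : V, ∃ p : PolynomialModule F⟦X⟧ V,
      A.lambdaBracket a b = (PowerSeries.X : F⟦X⟧) • p) :
    PoissonQuintuple F (QuasiclassicalLimit.Carrier F V) where
  one := QuasiclassicalLimit.proj F A.vac
  del := QuasiclassicalLimit.del A
  mul := QuasiclassicalLimit.mul A
  bracket := QuasiclassicalLimit.bracket A htf hbr

end

/-! Everything comes from two cases of the commutator formula in the vertex algebra over `F⟦X⟧`: the
commutator of `a_(m)` with `b_(n)` for `m ≥ 0` and for `m = -1`, as a combination of modes of the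
elements `a_(j)b`, `j ≥ 0`. The commutator `[a(z), b(w)]` expands along `z = w` with coefficients
`Res_z (z - w) ^ j [a(z), b(w)]` (`eq_sum_choose_mulZSubW`, `eq_sum_mulZSubW_of_iterate_eq_zero`).
These residues are the fields of `a_(j)b` by Goddard uniqueness (`eq_zero_of_isLocalPair`): both
sides are translation covariant, agree on the vacuum, and are local with every field, by Dong's
lemma.

Write `a_(j)b = ħ · divProd j a b`. For `m, n ≥ 0` every term of the formula carries `ħ²`;
cancelling it gives the Jacobi identity. For `n = -1` the terms with `j < m` carry `ħ²`, so after
one division by `ħ` they die in the quotient, and the Leibniz rule remains. For `m = n = -1` the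
whole right side lies in `ħV`, so left multiplications commute modulo `ħ`; applied to the vacuum
this gives commutativity, and the two together give associativity. The case `m = -1`, `n ≥ 0`,
applied to the vacuum, gives skew-symmetry once `v_(-1-i)|0⟩` is read as `T ^ i v / i!`.

Finally, multiplying by factorials, which is harmless in characteristic `0`, translates identities
between products into identities between polynomials in `λ` and `μ`. -/

noncomputable section

/-! ### Local pairs of formal distributions -/

section FormalDistributions

variable {U U' : Type*} [AddCommGroup U] [AddCommGroup U']

/-- `mulZSubW` as an additive map. -/
def mulZSubWHom (U : Type*) [AddCommGroup U] : (ℤ → ℤ → U) →+ (ℤ → ℤ → U) where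
  toFun := mulZSubW
  map_zero' := by funext m n; simp [mulZSubW]
  map_add' f g := by funext m n; simp only [mulZSubW, Pi.add_apply]; abel

theorem mulZSubW_iterate_zero (N : ℕ) : mulZSubW^[N] (0 : ℤ → ℤ → U) = 0 :=
  iterate_map_zero (mulZSubWHom U) N

theorem mulZSubW_iterate_sub (N : ℕ) (f g : ℤ → ℤ → U) :
    mulZSubW^[N] (f - g) = mulZSubW^[N] f - mulZSubW^[N] g :=
  iterate_map_sub (mulZSubWHom U) N f g

theorem mulZSubW_iterate_eq_zero_of_le {f : ℤ → ℤ → U} {M N : ℕ} (h : M ≤ N)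
    (hf : mulZSubW^[M] f = 0) : mulZSubW^[N] f = 0 := by
  obtain ⟨k, rfl⟩ := Nat.exists_eq_add_of_le' h
  rw [Function.iterate_add_apply, hf, mulZSubW_iterate_zero]

theorem mulZSubW_iterate_map (φ : U →+ U') (N : ℕ) (f : ℤ → ℤ → U) (m n : ℤ) :
    mulZSubW^[N] (fun m n => φ (f m n)) m n = φ (mulZSubW^[N] f m n) := by
  induction N generalizing m n with
  | zero => rfl
  | succ N ih => simp only [Function.iterate_succ_apply', mulZSubW, ih, map_sub]

/-- Both entries in `mulZSubW` lie on the same line of constant index sum, so it acts as a forward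
difference along that line. -/
theorem mulZSubW_iterate_eq_fwdDiff (N : ℕ) (f : ℤ → ℤ → U) (m n : ℤ) :
    mulZSubW^[N] f m n = (fwdDiff 1)^[N] (fun x => f x (m + n + N - x)) m := by
  induction N generalizing m n with
  | zero => simp
  | succ N ih =>
    rw [Function.iterate_succ_apply', Function.iterate_succ_apply', mulZSubW, ih, ih, fwdDiff]
    congr 1
    · refine congrArg (fun g => (fwdDiff 1)^[N] g (m + 1)) (funext fun x => ?_)
      congr 1; push_cast; ring
    · refine congrArg (fun g => (fwdDiff 1)^[N] g m) (funext fun x => ?_)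
      congr 1; push_cast; ring

/-- The expansion of a distribution in the variable `z` at `w`. -/
theorem eq_sum_choose_mulZSubW (f : ℤ → ℤ → U) (m : ℕ) (n : ℤ) :
    f m n = ∑ j ∈ Finset.range (m + 1), m.choose j • mulZSubW^[j] f 0 (m + n - j) := by
  -- Newton's forward difference formula; for `m ≥ 0` it is a finite sum, so locality plays no role.
  have h := shift_eq_sum_fwdDiff_iter (1 : ℤ) (fun x => f x (m + n - x)) m 0
  simp only [zero_add, nsmul_eq_mul, mul_one, add_sub_cancel_left] at h
  rw [h]
  refine Finset.sum_congr rfl fun j _ => ?_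
  rw [mulZSubW_iterate_eq_fwdDiff]
  congr 1
  refine congrArg (fun g => (fwdDiff 1)^[j] g 0) (funext fun x => ?_)
  congr 1
  ring

/-- Iterates `g (-1) (k + 1) = g 0 k - mulZSubW g (-1) k`. The signs are the binomial coefficients
of `-1`, and locality later removes the remainder. -/
theorem eq_sum_mulZSubW_add (f : ℤ → ℤ → U) (N : ℕ) (n : ℤ) :
    f (-1) n = ∑ j ∈ Finset.range N, (-1 : ℤ) ^ j • mulZSubW^[j] f 0 (n - 1 - j) +
      (-1 : ℤ) ^ N • mulZSubW^[N] f (-1) (n - N) := by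
  induction N with
  | zero => simp
  | succ N ih =>
    rw [ih, Finset.sum_range_succ, Function.iterate_succ_apply', mulZSubW, pow_succ, add_assoc]
    congr 1
    rw [show n - ((N + 1 : ℕ) : ℤ) + 1 = n - N by push_cast; ring,
      show n - ((N + 1 : ℕ) : ℤ) = n - 1 - N by push_cast; ring, show (-1 : ℤ) + 1 = 0 by norm_num]
    rw [mul_neg_one, neg_smul, smul_sub]
    abel

/-- The expansion at `m = -1` of a distribution killed by a power of `z - w`. -/
theorem eq_sum_mulZSubW_of_iterate_eq_zero {f : ℤ → ℤ → U} {N : ℕ} (hf : mulZSubW^[N] f = 0)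
    (n : ℤ) :
    f (-1) n = ∑ j ∈ Finset.range N, (-1 : ℤ) ^ j • mulZSubW^[j] f 0 (n - 1 - j) := by
  rw [eq_sum_mulZSubW_add f N n, hf]
  simp

/-- Multiplication by `z - w` is injective on series with only non-negative powers of `w`. -/
theorem eq_zero_of_mulZSubW_iterate_eq_zero {h : ℤ → ℤ → U} {N : ℕ}
    (hN : mulZSubW^[N] h = 0) (h0 : ∀ m n : ℤ, 0 ≤ n → h m n = 0) : h = 0 := by
  induction N generalizing h with
  | zero => exact hN
  | succ N ih =>
    have h1 : mulZSubW h = 0 := by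
      refine ih (by rwa [Function.iterate_succ_apply] at hN) fun m n hn => ?_
      rw [mulZSubW, h0 _ _ hn, h0 _ _ (by omega), sub_zero]
    -- A distribution killed by `z - w` is constant along lines of constant index sum, and each such
    -- line reaches `n ≥ 0`.
    have h2 : ∀ (k : ℕ) (m n : ℤ), -k ≤ n → h m n = 0 := by
      intro k
      induction k with
      | zero => intro m n hn; exact h0 m n (by simpa using hn)
      | succ k ihk =>
        intro m n hn
        have h3 : h (m - 1 + 1) n - h (m - 1) (n + 1) = 0 := congrFun₂ h1 (m - 1) n
        rwa [ihk (m - 1) (n + 1) (by push_cast at hn; omega), sub_zero, sub_add_cancel] at h3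
    funext m n
    exact h2 n.natAbs m n (by omega)

end FormalDistributions

/-! ### Dong's lemma -/

section Dong

variable {U : Type*} [AddCommGroup U]

/-- Multiplication by `z - w` on distributions in `z`, `w`, `u`. -/
def mulFstSubSnd (U : Type*) [AddCommGroup U] : Module.End ℤ (ℤ → ℤ → ℤ → U) :=
  AddMonoidHom.toIntLinearMap
    { toFun := fun f m n k => f (m + 1) n k - f m (n + 1) k
      map_zero' := by funext m n k; simp
      map_add' := fun f g => by funext m n k; simp only [Pi.add_apply]; abel }

/-- Multiplication by `w - u` on distributions in `z`, `w`, `u`. -/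
def mulSndSubThd (U : Type*) [AddCommGroup U] : Module.End ℤ (ℤ → ℤ → ℤ → U) :=
  AddMonoidHom.toIntLinearMap
    { toFun := fun f m n k => f m (n + 1) k - f m n (k + 1)
      map_zero' := by funext m n k; simp
      map_add' := fun f g => by funext m n k; simp only [Pi.add_apply]; abel }

/-- Multiplication by `z - u` on distributions in `z`, `w`, `u`. -/
def mulFstSubThd (U : Type*) [AddCommGroup U] : Module.End ℤ (ℤ → ℤ → ℤ → U) :=
  mulFstSubSnd U + mulSndSubThd U

theorem mulFstSubSnd_apply (f : ℤ → ℤ → ℤ → U) (m n k : ℤ) :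
    mulFstSubSnd U f m n k = f (m + 1) n k - f m (n + 1) k := rfl

theorem mulSndSubThd_apply (f : ℤ → ℤ → ℤ → U) (m n k : ℤ) :
    mulSndSubThd U f m n k = f m (n + 1) k - f m n (k + 1) := rfl

theorem mulFstSubThd_apply (f : ℤ → ℤ → ℤ → U) (m n k : ℤ) :
    mulFstSubThd U f m n k = f (m + 1) n k - f m n (k + 1) := by
  simp [mulFstSubThd, mulFstSubSnd_apply, mulSndSubThd_apply]

theorem commute_mulFstSubSnd_mulSndSubThd : Commute (mulFstSubSnd U) (mulSndSubThd U) := by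
  refine LinearMap.ext fun f => ?_
  funext m n k
  simp only [Module.End.mul_apply, mulFstSubSnd_apply, mulSndSubThd_apply]
  abel

theorem commute_mulFstSubThd_mulSndSubThd : Commute (mulFstSubThd U) (mulSndSubThd U) :=
  commute_mulFstSubSnd_mulSndSubThd.add_left (Commute.refl _)

theorem commute_mulFstSubThd_mulFstSubSnd : Commute (mulFstSubThd U) (mulFstSubSnd U) :=
  (Commute.refl _).add_left commute_mulFstSubSnd_mulSndSubThd.symm

theorem mulFstSubSnd_pow_apply (N : ℕ) (f : ℤ → ℤ → ℤ → U) (m n k : ℤ) :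
    (mulFstSubSnd U ^ N) f m n k = mulZSubW^[N] (fun m n => f m n k) m n := by
  induction N generalizing m n with
  | zero => rfl
  | succ N ih =>
    rw [pow_succ', Module.End.mul_apply, mulFstSubSnd_apply, ih, ih, Function.iterate_succ_apply']
    rfl

theorem mulSndSubThd_pow_apply (N : ℕ) (f : ℤ → ℤ → ℤ → U) (m n k : ℤ) :
    (mulSndSubThd U ^ N) f m n k = mulZSubW^[N] (f m) n k := by
  induction N generalizing n k with
  | zero => rfl
  | succ N ih =>
    rw [pow_succ', Module.End.mul_apply, mulSndSubThd_apply, ih, ih, Function.iterate_succ_apply']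
    rfl

theorem mulFstSubThd_pow_apply (N : ℕ) (f : ℤ → ℤ → ℤ → U) (m n k : ℤ) :
    (mulFstSubThd U ^ N) f m n k = mulZSubW^[N] (fun m k => f m n k) m k := by
  induction N generalizing m k with
  | zero => rfl
  | succ N ih =>
    rw [pow_succ', Module.End.mul_apply, mulFstSubThd_apply, ih, ih, Function.iterate_succ_apply']
    rfl

/-- In the binomial expansion of exponent `2 * N`, each term has exponent at least `N` on `x` or on
`y`. -/
theorem sub_pow_apply_eq_zero {M : Type*} [AddCommGroup M] {x y : Module.End ℤ M}
    (hxy : Commute x y) {N : ℕ} {v : M} (hx : (x ^ N) v = 0) (hy : (y ^ N) v = 0) :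
    ((x - y) ^ (2 * N)) v = 0 := by
  rw [sub_eq_add_neg, hxy.neg_right.add_pow, LinearMap.sum_apply]
  refine Finset.sum_eq_zero fun i _ => ?_
  have key : ∀ z w : Module.End ℤ M, Commute z w → ∀ p q r : ℕ, N ≤ p → (z ^ N) v = 0 →
      (z ^ p * (-w) ^ q * (r : Module.End ℤ M)) v = 0 := by
    intro z w hzw p q r hp hz
    obtain ⟨s, rfl⟩ := Nat.exists_eq_add_of_le' hp
    rw [(Nat.commute_cast (z ^ (s + N) * (-w) ^ q) r).eq, (hzw.neg_right.pow_pow _ _).eq, pow_add]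
    simp only [Module.End.mul_apply, hz, map_zero]
  rcases le_total N i with h | h
  · exact key x y hxy _ _ _ h hx
  · have h3 := key (-y) (-x) (hxy.symm.neg_left.neg_right) (2 * N - i) i ((2 * N).choose i)
      (by omega) (by rw [neg_pow]; simp [Module.End.mul_apply, hy])
    rwa [neg_neg, ← (hxy.neg_right.pow_pow _ _).eq] at h3

variable {A : Type*} [LieRing A]

/-- The pair of distributions `a(z)`, `b(z)` is local. -/
def IsLocalPair (a b : ℤ → A) : Prop :=
  ∃ N : ℕ, mulZSubW^[N] (fun m n : ℤ => ⁅a m, b n⁆) = 0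

/-- The coefficients of the `j`-th product `Res_z (z - w) ^ j [a(z), b(w)]`. -/
def distProd (j : ℕ) (a b : ℤ → A) : ℤ → A :=
  fun n => mulZSubW^[j] (fun m n : ℤ => ⁅a m, b n⁆) 0 n

theorem IsLocalPair.sub_left {a b c : ℤ → A} (hac : IsLocalPair a c) (hbc : IsLocalPair b c) :
    IsLocalPair (a - b) c := by
  obtain ⟨M, hM⟩ := hac
  obtain ⟨N, hN⟩ := hbc
  refine ⟨M + N, ?_⟩
  have h : (fun m n : ℤ => ⁅(a - b) m, c n⁆) = (fun m n => ⁅a m, c n⁆) - fun m n => ⁅b m, c n⁆ := by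
    funext m n
    simp only [Pi.sub_apply, sub_lie]
  rw [h, mulZSubW_iterate_sub, mulZSubW_iterate_eq_zero_of_le (Nat.le_add_right M N) hM,
    mulZSubW_iterate_eq_zero_of_le (Nat.le_add_left N M) hN, sub_zero]

/-- Dong's lemma. -/
theorem IsLocalPair.distProd_left {a b c : ℤ → A} (hab : IsLocalPair a b) (hac : IsLocalPair a c)
    (hbc : IsLocalPair b c) (j : ℕ) : IsLocalPair (distProd j a b) c := by
  obtain ⟨N₁, h₁⟩ := hab
  obtain ⟨N₂, h₂⟩ := hac
  obtain ⟨N₃, h₃⟩ := hbc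
  obtain ⟨N, hN₁, hN₂, hN₃⟩ : ∃ N, N₁ ≤ N ∧ N₂ ≤ N ∧ N₃ ≤ N :=
    ⟨N₁ + N₂ + N₃, by omega, by omega, by omega⟩
  replace h₁ := mulZSubW_iterate_eq_zero_of_le hN₁ h₁
  replace h₂ := mulZSubW_iterate_eq_zero_of_le hN₂ h₂
  replace h₃ := mulZSubW_iterate_eq_zero_of_le hN₃ h₃
  let lieLeft : A → A →+ A := fun x =>
    AddMonoidHom.mk' (fun y => ⁅x, y⁆) (lie_add x)
  let lieRight : A → A →+ A := fun x =>
    AddMonoidHom.mk' (fun y => ⁅y, x⁆) (fun y z => add_lie y z x)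
  let f : ℤ → ℤ → ℤ → A := fun m n k => ⁅⁅a m, b n⁆, c k⁆
  let f₁ : ℤ → ℤ → ℤ → A := fun m n k => ⁅a m, ⁅b n, c k⁆⁆
  let f₂ : ℤ → ℤ → ℤ → A := fun m n k => ⁅b n, ⁅a m, c k⁆⁆
  have hf : f = f₁ - f₂ := by
    funext m n k
    exact lie_lie (a m) (b n) (c k)
  have e12 : (mulFstSubSnd A ^ N) f = 0 := by
    funext m n k
    rw [mulFstSubSnd_pow_apply]
    refine (mulZSubW_iterate_map (lieRight (c k)) N (fun m n => ⁅a m, b n⁆) m n).trans ?_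
    rw [h₁]; exact map_zero _
  have e23 : (mulSndSubThd A ^ N) f₁ = 0 := by
    funext m n k
    rw [mulSndSubThd_pow_apply]
    refine (mulZSubW_iterate_map (lieLeft (a m)) N (fun n k => ⁅b n, c k⁆) n k).trans ?_
    rw [h₃]; exact map_zero _
  have e13 : (mulFstSubThd A ^ N) f₂ = 0 := by
    funext m n k
    rw [mulFstSubThd_pow_apply]
    refine (mulZSubW_iterate_map (lieLeft (b n)) N (fun m k => ⁅a m, c k⁆) m k).trans ?_
    rw [h₂]; exact map_zero _
  have c1 := (commute_mulFstSubThd_mulSndSubThd (U := A)).pow_pow N N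
  have c2 := (commute_mulFstSubSnd_mulSndSubThd (U := A)).pow_pow N N
  -- Write `2 * N` of the factors `w - u` as `(z - u) - (z - w)`. The power `(z - w) ^ N` kills `f`.
  -- The other `N` factors `w - u` kill `f₁`, and `(z - u) ^ N` kills `f₂`, so their product kills
  -- `f = f₁ - f₂`.
  have e : (mulSndSubThd A ^ (2 * N + N)) f = 0 := by
    rw [pow_add, Module.End.mul_apply]
    rw [show mulSndSubThd A = mulFstSubThd A - mulFstSubSnd A by simp [mulFstSubThd]]
    refine sub_pow_apply_eq_zero commute_mulFstSubThd_mulFstSubSnd ?_ ?_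
    · rw [show mulFstSubThd A - mulFstSubSnd A = mulSndSubThd A by simp [mulFstSubThd],
        ← Module.End.mul_apply, hf, map_sub, c1.eq, Module.End.mul_apply _ _ f₂, e13, map_zero,
        ← c1.eq, Module.End.mul_apply, e23, map_zero, sub_zero]
    · rw [show mulFstSubThd A - mulFstSubSnd A = mulSndSubThd A by simp [mulFstSubThd],
        ← Module.End.mul_apply, c2.eq, Module.End.mul_apply, e12, map_zero]
  refine ⟨2 * N + N, ?_⟩
  funext n k
  -- Multiplication by `(z - w) ^ j` commutes with that by `w - u`; the slice at first index `0` is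
  -- the residue in `z`.
  have h4 : (mulSndSubThd A ^ (2 * N + N)) ((mulFstSubSnd A ^ j) f) 0 n k = 0 := by
    rw [← Module.End.mul_apply,
      ((commute_mulFstSubSnd_mulSndSubThd (U := A)).pow_pow j (2 * N + N)).eq.symm,
      Module.End.mul_apply, e, map_zero]
    rfl
  rw [mulSndSubThd_pow_apply] at h4
  refine Eq.trans ?_ h4
  refine congrArg (fun g => mulZSubW^[2 * N + N] g n k) ?_
  funext n k
  rw [mulFstSubSnd_pow_apply]
  exact (mulZSubW_iterate_map (lieRight (c k)) j (fun m n => ⁅a m, b n⁆) 0 n).symm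

/-- If `a` and `b` are translation covariant with respect to `t`, so is their `j`-th product. -/
theorem lie_distProd {t : A} {a b : ℤ → A} (ha : ∀ n, ⁅t, a n⁆ = -(n • a (n - 1)))
    (hb : ∀ n, ⁅t, b n⁆ = -(n • b (n - 1))) (j : ℕ) (n : ℤ) :
    ⁅t, distProd j a b n⁆ = -(n • distProd j a b (n - 1)) := by
  -- The induction on `j` needs all first indices. At `m = 0` the `z`-derivative drops out, having
  -- no residue.
  have key : ∀ m n : ℤ, ⁅t, mulZSubW^[j] (fun m n : ℤ => ⁅a m, b n⁆) m n⁆ =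
      -(m • mulZSubW^[j] (fun m n : ℤ => ⁅a m, b n⁆) (m - 1) n) -
        n • mulZSubW^[j] (fun m n : ℤ => ⁅a m, b n⁆) m (n - 1) := by
    induction j with
    | zero =>
      intro m n
      simp only [Function.iterate_zero, id]
      rw [leibniz_lie, ha, hb]
      simp only [neg_lie, lie_neg, smul_lie, lie_smul]
      abel
    | succ j ih =>
      intro m n
      simp only [Function.iterate_succ_apply', mulZSubW, lie_sub, ih, add_sub_cancel_right,
        sub_add_cancel, add_smul, one_smul, smul_sub]
      abel
  have h := key 0 n
  rwa [zero_smul, neg_zero, zero_sub] at h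

end Dong

/-! ### The commutator formula -/

namespace VertexAlgebra

variable {R V : Type*} [CommRing R] [AddCommGroup V] [Module R V] (A : VertexAlgebra R V)

attribute [local instance] LieRing.ofAssociativeRing

/-- The coefficients `a_(n)` of `a(z)`. -/
def field (a : V) : ℤ → Module.End R V := VertexOperator.ncoeff (A.Y a)

theorem field_apply (a b : V) (n : ℤ) : A.field a n b = A.nProd n a b := rfl

theorem isLocalPair_field (a b : V) : IsLocalPair (A.field a) (A.field b) := by
  obtain ⟨N, hN⟩ := A.locality a b
  refine ⟨N, ?_⟩
  rw [← sub_eq_zero, ← mulZSubW_iterate_sub] at hN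
  exact hN

/-- The derivation rule for `|0⟩_(-1)|0⟩ = |0⟩` reads `T|0⟩ = T|0⟩ + T|0⟩`. -/
theorem T_vac : A.T A.vac = 0 := by
  have h := A.T_derivation A.vac A.vac (-1)
  rw [A.vac_Y, A.Y_vac _ _ le_rfl, A.vac_Y] at h
  simpa using h

theorem lie_T_field (a : V) (n : ℤ) : ⁅A.T, A.field a n⁆ = -(n • A.field a (n - 1)) := by
  refine LinearMap.ext fun b => ?_
  have h : A.T (A.field a n b) = VertexOperator.ncoeff (A.Y (A.T a)) n b + A.field a n (A.T b) :=
    A.T_derivation a b n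
  rw [A.Y_T] at h
  simp only [Ring.lie_def, LinearMap.sub_apply, Module.End.mul_apply, h, add_sub_cancel_right]
  rfl

theorem field_vac_of_nonneg (a : V) {n : ℤ} (hn : 0 ≤ n) : A.field a n A.vac = 0 := by
  have h := A.Y_vac a n (by omega)
  rwa [if_neg (by omega)] at h

theorem field_neg_one_vac (a : V) : A.field a (-1) A.vac = a := by
  have h := A.Y_vac a (-1) le_rfl
  rwa [if_pos rfl] at h

theorem normalProd_vac (a : V) : A.normalProd a A.vac = a := A.field_neg_one_vac a

theorem vac_normalProd (a : V) : A.normalProd A.vac a = a := (A.vac_Y a (-1)).trans (if_pos rfl)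

theorem distProd_field_vac (a b : V) (j : ℕ) {n : ℤ} (hn : 0 ≤ n) :
    distProd j (A.field a) (A.field b) n A.vac = 0 ∧
      distProd j (A.field a) (A.field b) (-1) A.vac = A.nProd j a b := by
  -- For `m ≥ 0` the mode `a_(m)` kills the vacuum, so only `a_(m)b_(n)|0⟩` survives, and this is
  -- zero for `n ≥ 0`. Each factor `z - w` then acts at `n = -1` by raising `m` alone, whence the
  -- induction over all `m`.
  have key : ∀ m : ℕ, (∀ n : ℤ, 0 ≤ n →
      mulZSubW^[j] (fun m n : ℤ => ⁅A.field a m, A.field b n⁆) m n A.vac = 0) ∧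
      mulZSubW^[j] (fun m n : ℤ => ⁅A.field a m, A.field b n⁆) m (-1) A.vac =
        A.nProd (m + j) a b := by
    induction j with
    | zero =>
      intro m
      have h : A.field a m A.vac = 0 := A.field_vac_of_nonneg a (Int.natCast_nonneg m)
      refine ⟨fun n hn => ?_, ?_⟩
      · simp [Ring.lie_def, h, A.field_vac_of_nonneg b hn]
      · simp [Ring.lie_def, h, A.field_neg_one_vac, ← field_apply]
    | succ j ih =>
      intro m
      have h1 := ih m
      have h2 := ih (m + 1)
      push_cast at h2
      simp only [Function.iterate_succ_apply', mulZSubW, LinearMap.sub_apply]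
      refine ⟨fun n hn => ?_, ?_⟩
      · rw [h2.1 n hn, h1.1 _ (by omega), sub_zero]
      · rw [h2.2, neg_add_cancel, h1.1 0 le_rfl, sub_zero]
        congr 1
        push_cast
        ring
  have h0 := key 0
  rw [Nat.cast_zero, zero_add] at h0
  exact ⟨h0.1 n hn, h0.2⟩

/-- A translation covariant distribution which is local with all fields and kills `|0⟩` modulo
negative powers is zero (Goddard's uniqueness theorem). -/
theorem eq_zero_of_isLocalPair [IsAddTorsionFree V] {d : ℤ → Module.End R V}
    (hT : ∀ n, ⁅A.T, d n⁆ = -(n • d (n - 1))) (hd : ∀ n, -1 ≤ n → d n A.vac = 0)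
    (hloc : ∀ c : V, IsLocalPair d (A.field c)) : d = 0 := by
  -- Covariance and `T|0⟩ = 0` give the recursion `n • d (n - 1)|0⟩ = -T (d n |0⟩)`, and `n = -1 -
  -- k` is never zero.
  have hneg : ∀ k : ℕ, d (-1 - k) A.vac = 0 := by
    intro k
    induction k with
    | zero => exact hd _ (by simp)
    | succ k ih =>
      have h := LinearMap.congr_fun (hT (-1 - k)) A.vac
      simp only [Ring.lie_def, LinearMap.sub_apply, Module.End.mul_apply, ih, A.T_vac, map_zero,
        sub_zero, LinearMap.neg_apply, LinearMap.smul_apply] at h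
      have h' := (smul_eq_zero.1 (neg_eq_zero.1 h.symm)).resolve_left (by omega)
      rwa [show -1 - ((k + 1 : ℕ) : ℤ) = -1 - k - 1 by push_cast; ring]
  have hvac : ∀ n, d n A.vac = 0 := by
    intro n
    rcases le_or_gt (-1) n with h | h
    · exact hd n h
    · have := hneg (-1 - n).toNat
      rwa [show -1 - (((-1 - n).toNat : ℕ) : ℤ) = n by omega] at this
  funext m
  refine LinearMap.ext fun c => ?_
  obtain ⟨N, hN⟩ := hloc c
  -- As `d(z)` kills the vacuum, `d(z)c(w)|0⟩ = [d(z), c(w)]|0⟩`. A power of `z - w` kills it and it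
  -- has no negative powers of `w`, so it vanishes; its value at `w = 0` is `d(z)c`.
  have h0 : (fun m n : ℤ => d m (A.field c n A.vac)) = 0 := by
    refine eq_zero_of_mulZSubW_iterate_eq_zero (N := N) ?_ fun m n hn => ?_
    · funext m n
      have h := mulZSubW_iterate_map (LinearMap.applyₗ (R := R) A.vac).toAddMonoidHom N
        (fun m n => ⁅d m, A.field c n⁆) m n
      rw [hN] at h
      have hcomm : (fun m n : ℤ => d m (A.field c n A.vac)) =
          fun m n => (LinearMap.applyₗ (R := R) A.vac).toAddMonoidHom ⁅d m, A.field c n⁆ := by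
        funext m n
        simp [Ring.lie_def, hvac]
      rw [hcomm, h]
      simp
    · rw [A.field_vac_of_nonneg c hn, map_zero]
  have h1 := congrFun₂ h0 m (-1)
  rwa [A.field_neg_one_vac] at h1

/-- The difference of the two sides meets the hypotheses of the uniqueness theorem; Dong's lemma
supplies locality. -/
theorem distProd_field [IsAddTorsionFree V] (a b : V) (j : ℕ) :
    distProd j (A.field a) (A.field b) = A.field (A.nProd j a b) := by
  rw [← sub_eq_zero]
  refine A.eq_zero_of_isLocalPair (fun n => ?_) (fun n hn => ?_) fun c => ?_
  · rw [Pi.sub_apply, Pi.sub_apply, lie_sub,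
      lie_distProd (A.lie_T_field a) (A.lie_T_field b), A.lie_T_field, smul_sub]
    abel
  · rw [Pi.sub_apply, LinearMap.sub_apply]
    rcases eq_or_lt_of_le hn with rfl | hn
    · rw [(A.distProd_field_vac a b j le_rfl).2, A.field_neg_one_vac, sub_self]
    · have hn : 0 ≤ n := by omega
      rw [(A.distProd_field_vac a b j hn).1, A.field_vac_of_nonneg _ hn, sub_self]
  · exact ((A.isLocalPair_field a b).distProd_left (A.isLocalPair_field a c)
      (A.isLocalPair_field b c) j).sub_left (A.isLocalPair_field _ c)

/-- The commutator formula `[a_(m), b_(n)] = ∑_j (m choose j) (a_(j)b)_(m+n-j)`, for `m ≥ 0`. -/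
theorem nProd_comm [IsAddTorsionFree V] (m : ℕ) (n : ℤ) (a b c : V) :
    A.nProd m a (A.nProd n b c) - A.nProd n b (A.nProd m a c) =
      ∑ j ∈ Finset.range (m + 1), m.choose j • A.nProd (m + n - j) (A.nProd j a b) c := by
  have h := eq_sum_choose_mulZSubW (fun m n : ℤ => ⁅A.field a m, A.field b n⁆) m n
  have h' := LinearMap.congr_fun h c
  rw [LinearMap.sum_apply] at h'
  refine (Eq.trans ?_ h').trans (Finset.sum_congr rfl fun j _ => ?_)
  · rfl
  · rw [LinearMap.smul_apply]
    congr 1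
    exact congrArg (fun g : ℤ → Module.End R V => g (m + n - j) c) (A.distProd_field a b j)

/-- The commutator formula `[a_(-1), b_(n)] = ∑_j (-1) ^ j (a_(j)b)_(n-1-j)`. -/
theorem exists_nProd_neg_one_comm [IsAddTorsionFree V] (a b : V) :
    ∃ N : ℕ, (∀ j : ℕ, N ≤ j → A.nProd j a b = 0) ∧ ∀ (M : ℕ), N ≤ M → ∀ (n : ℤ) (c : V),
      A.nProd (-1) a (A.nProd n b c) - A.nProd n b (A.nProd (-1) a c) =
        ∑ j ∈ Finset.range M, (-1 : ℤ) ^ j • A.nProd (n - 1 - j) (A.nProd j a b) c := by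
  obtain ⟨N, hN⟩ := A.isLocalPair_field a b
  refine ⟨N, fun j hj => ?_, fun M hM n c => ?_⟩
  -- `a_(j)b` is read off from the `j`-th residue on the vacuum, which locality kills for `j ≥ N`.
  · rw [← (A.distProd_field_vac a b j le_rfl).2, distProd,
      mulZSubW_iterate_eq_zero_of_le hj hN]
    rfl
  have h := eq_sum_mulZSubW_of_iterate_eq_zero (mulZSubW_iterate_eq_zero_of_le hM hN) n
  have h' := LinearMap.congr_fun h c
  rw [LinearMap.sum_apply] at h'
  refine (Eq.trans ?_ h').trans (Finset.sum_congr rfl fun j _ => ?_)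
  · rfl
  · rw [LinearMap.smul_apply]
    congr 1
    exact congrArg (fun g : ℤ → Module.End R V => g (n - 1 - j) c) (A.distProd_field a b j)

/-- `T ^ i v = i! v_(-1-i)|0⟩`. -/
theorem T_pow_eq (v : V) (i : ℕ) : (A.T ^ i) v = i.factorial • A.nProd (-1 - i) v A.vac := by
  induction i with
  | zero => simp [← field_apply, A.field_neg_one_vac]
  | succ i ih =>
    have h := LinearMap.congr_fun (A.lie_T_field v (-1 - i)) A.vac
    simp only [Ring.lie_def, LinearMap.sub_apply, Module.End.mul_apply, A.T_vac, map_zero,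
        sub_zero, LinearMap.neg_apply, LinearMap.smul_apply, field_apply] at h
    rw [pow_succ', Module.End.mul_apply, ih, map_nsmul, h, Nat.factorial_succ, mul_comm, mul_nsmul,
      ← neg_smul, show -1 - ((i + 1 : ℕ) : ℤ) = -1 - i - 1 by push_cast; ring, smul_comm,
      show -(-1 - (i : ℤ)) = ((i + 1 : ℕ) : ℤ) by push_cast; ring, natCast_zsmul]

/-- Skew-symmetry `b_(m)a = -∑_j (-1) ^ j (a_(j)b)_(m-1-j)|0⟩` of the products with `m ≥ 0`. -/
theorem exists_nProd_skew [IsAddTorsionFree V] (a b : V) :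
    ∃ N : ℕ, (∀ j : ℕ, N ≤ j → A.nProd j a b = 0) ∧ ∀ m : ℕ,
      A.nProd m b a = -∑ j ∈ Finset.range N, if j < m then 0 else
        (-1 : ℤ) ^ j • A.nProd (-1 - (j - m : ℕ)) (A.nProd j a b) A.vac := by
  obtain ⟨N, h0, hN⟩ := A.exists_nProd_neg_one_comm a b
  refine ⟨N, h0, fun m => ?_⟩
  -- On the vacuum `b_(m)` gives `0` and `a_(-1)` gives `a`, so the commutator reduces to `-b_(m)a`.
  have h := hN N le_rfl m A.vac
  simp only [← field_apply A] at h ⊢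
  rw [A.field_vac_of_nonneg b (Int.natCast_nonneg m), map_zero, zero_sub, A.field_neg_one_vac,
    neg_eq_iff_eq_neg] at h
  rw [h]
  congr 1
  refine Finset.sum_congr rfl fun j _ => ?_
  split_ifs with hj
  -- Here the index `m - 1 - j` is non-negative, so the mode kills the vacuum.
  · rw [A.field_vac_of_nonneg _ (by omega), smul_zero]
  · congr 3
    omega

end VertexAlgebra

/-! ### Coefficients of polynomial identities -/

section PolynomialCoefficients

variable {F V M W : Type*} [Field F] [AddCommGroup V] [Module F V] [AddCommGroup M] [Module F M]
  [AddCommGroup W] [Module F W]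

theorem map_substVar (φ : V →ₗ[F] M) (D : M →ₗ[F] M) (ψ : M →ₗ[F] W) (p : PolynomialModule F V) :
    ψ (substVar φ D p) = p.coeff.sum fun n v => ψ ((D ^ n) (φ v)) := by
  simp [substVar, Finsupp.sum]

/-- Serves to extract coefficients: with `ψ` a coefficient map, a small explicit `s` replaces the
support of `p`. -/
theorem map_substVar_eq_sum (φ : V →ₗ[F] M) (D : M →ₗ[F] M) (ψ : M →ₗ[F] W)
    (p : PolynomialModule F V) (s : Finset ℕ)
    (hs : ∀ n, n ∉ s → ψ ((D ^ n) (φ (p.coeff n))) = 0) :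
    ψ (substVar φ D p) = ∑ n ∈ s, ψ ((D ^ n) (φ (p.coeff n))) := by
  rw [map_substVar, Finsupp.sum]
  refine Finset.sum_congr_of_eq_on_inter (fun n _ hn => hs n hn) (fun n _ hn => ?_)
    fun n _ _ => rfl
  simp [Finsupp.notMem_support_iff.1 hn]

variable (F) in
/-- The `n`-th coefficient as a linear map. -/
def lcoeff (n : ℕ) : PolynomialModule F V →ₗ[F] V :=
  Finsupp.lapply n ∘ₗ (PolynomialModule.coeffLinearEquiv F F).toLinearMap

theorem lcoeff_apply (n : ℕ) (p : PolynomialModule F V) : lcoeff F n p = p.coeff n := rfl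

theorem coeff_map (f : V →ₗ[F] M) (p : PolynomialModule F V) (n : ℕ) :
    (PolynomialModule.map F f p).coeff n = f (p.coeff n) := rfl

theorem coeff_mulVar (p : PolynomialModule F V) (n : ℕ) :
    (mulVar F V p).coeff n = if n = 0 then 0 else p.coeff (n - 1) := by
  have h : mulVar F V p = Polynomial.monomial 1 (1 : F) • p := rfl
  rw [h, PolynomialModule.monomial_smul_apply]
  rcases n with _ | n <;> simp

theorem coeff_mulVar_pow (p : PolynomialModule F V) (k n : ℕ) :
    ((mulVar F V ^ k) p).coeff n = if k ≤ n then p.coeff (n - k) else 0 := by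
  induction k generalizing n with
  | zero => simp
  | succ k ih =>
    rw [pow_succ', Module.End.mul_apply, coeff_mulVar]
    rcases n with _ | n
    · simp
    · simp [ih]

theorem coeff_mulLambda (p : Poly₂ F V) (n m : ℕ) :
    ((mulLambda F V p).coeff n).coeff m = if m = 0 then 0 else (p.coeff n).coeff (m - 1) :=
  coeff_mulVar _ _

theorem coeff_mulLambda_pow (p : Poly₂ F V) (k n m : ℕ) :
    (((mulLambda F V ^ k) p).coeff n).coeff m =
      if k ≤ m then (p.coeff n).coeff (m - k) else 0 := by
  induction k generalizing m with
  | zero => simp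
  | succ k ih =>
    rw [pow_succ', Module.End.mul_apply, coeff_mulLambda]
    rcases m with _ | m
    · simp
    · simp [ih]

theorem coeff_mulMu (p : Poly₂ F V) (n m : ℕ) :
    ((mulMu F V p).coeff n).coeff m = if n = 0 then 0 else (p.coeff (n - 1)).coeff m := by
  rw [mulMu, coeff_mulVar]
  split_ifs <;> rfl

theorem coeff_inclLambda (p : PolynomialModule F V) (n : ℕ) :
    (inclLambda F V p).coeff n = if n = 0 then p else 0 := by
  rw [inclLambda, PolynomialModule.lsingle_apply]
  simp only [eq_comm]

theorem coeff_inclMu (p : PolynomialModule F V) (n m : ℕ) :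
    ((inclMu F V p).coeff n).coeff m = if m = 0 then p.coeff n else 0 := by
  rw [inclMu, coeff_map, PolynomialModule.lsingle_apply]
  simp only [eq_comm]

/-- The binomial theorem, by Pascal's rule; the outer index `n` is the exponent of `μ`, the inner
index `m` that of `λ`. -/
theorem coeff_mulLambda_add_mulMu_pow (v : V) (l n m : ℕ) :
    ((((mulLambda F V + mulMu F V) ^ l)
      (inclLambda F V (PolynomialModule.lsingle F 0 v))).coeff n).coeff m =
      if m + n = l then l.choose m • v else 0 := by
  induction l generalizing n m with
  | zero =>
    rcases n with _ | n <;> rcases m with _ | m <;>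
      simp [coeff_inclLambda, PolynomialModule.lsingle_apply]
  | succ l ih =>
    rw [pow_succ', Module.End.mul_apply, LinearMap.add_apply, PolynomialModule.coeff_add,
      Finsupp.add_apply, PolynomialModule.coeff_add, Finsupp.add_apply, coeff_mulLambda,
      coeff_mulMu, ih, ih]
    rcases n with _ | n <;> rcases m with _ | m
    · simp
    · by_cases h : m = l
      · simp [h]
      · simp [h]
    · by_cases h : n = l
      · simp [h]
      · simp [h]
    · by_cases h : m + 1 + n = l
      · have h1 : m + (n + 1) = l := by omega
        have h2 : m + 1 + (n + 1) = l + 1 := by omega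
        simp [h, h1, h2, Nat.choose_succ_succ, add_smul]
      · have h1 : ¬ m + (n + 1) = l := by omega
        have h2 : ¬ m + 1 + (n + 1) = l + 1 := by omega
        simp [h, h1, h2]

theorem coeff_skew_pow (del : V →ₗ[F] V) (v : V) (n k : ℕ) :
    (((-mulVar F V - PolynomialModule.map F del) ^ n) (PolynomialModule.lsingle F 0 v)).coeff k =
      (-1 : ℤ) ^ n • n.choose k • (del ^ (n - k)) v := by
  induction n generalizing k with
  | zero => rcases k with _ | k <;> simp [PolynomialModule.lsingle_apply]
  | succ n ih =>
    rw [pow_succ', Module.End.mul_apply]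
    set x := ((-mulVar F V - PolynomialModule.map F del) ^ n) (PolynomialModule.lsingle F 0 v)
    have h : ((-mulVar F V - PolynomialModule.map F del) x).coeff k =
        -(if k = 0 then 0 else x.coeff (k - 1)) - del (x.coeff k) := by
      rw [← coeff_mulVar]
      rfl
    rw [h, ih, pow_succ, mul_neg_one, neg_smul]
    rcases k with _ | k
    · simp [ih, pow_succ']
    · rw [if_neg (by omega), Nat.add_sub_cancel, ih, map_zsmul, map_nsmul,
        Nat.choose_succ_succ, add_smul, smul_add, Nat.add_sub_add_right]
      -- For `k + 1 > n` the subtraction truncates, but then the binomial coefficient in front is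
      -- zero.
      rcases le_or_gt (k + 1) n with hk | hk
      · rw [show n - k = n - (k + 1) + 1 by omega, pow_succ', Module.End.mul_apply]
        abel
      · simp [Nat.choose_eq_zero_of_lt hk]

variable (br : V →ₗ[F] V →ₗ[F] PolynomialModule F V)

theorem coeff_bracketLambda (a : V) (p : PolynomialModule F V) (n m : ℕ) :
    ((bracketLambda br a p).coeff n).coeff m = (br a (p.coeff n)).coeff m := by
  have h := map_substVar_eq_sum (inclLambda F V ∘ₗ br a) (mulMu F V) (lcoeff F m ∘ₗ lcoeff F n) p
    {n} fun k hk => by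
      rw [Finset.mem_singleton] at hk
      simp only [LinearMap.comp_apply, lcoeff_apply, mulMu, coeff_mulVar_pow, coeff_inclLambda]
      split_ifs <;> first | rfl | omega
  refine h.trans ?_
  simp only [Finset.sum_singleton, LinearMap.comp_apply, lcoeff_apply, mulMu, coeff_mulVar_pow,
    coeff_inclLambda]
  simp

theorem coeff_bracketMu (b : V) (p : PolynomialModule F V) (n m : ℕ) :
    ((bracketMu br b p).coeff n).coeff m = (br b (p.coeff m)).coeff n := by
  have h := map_substVar_eq_sum (inclMu F V ∘ₗ br b) (mulLambda F V) (lcoeff F m ∘ₗ lcoeff F n) p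
    {m} fun k hk => by
      rw [Finset.mem_singleton] at hk
      simp only [LinearMap.comp_apply, lcoeff_apply, coeff_mulLambda_pow, coeff_inclMu]
      split_ifs <;> first | rfl | omega
  refine h.trans ?_
  simp only [Finset.sum_singleton, LinearMap.comp_apply, lcoeff_apply, coeff_mulLambda_pow,
    coeff_inclMu]
  simp

/-- A factor `λ ^ k` comes from `p`; the remaining `λ ^ (m - k) μ ^ n` must come from `(λ + μ) ^ (m
- k + n)`. -/
theorem coeff_bracketLambdaAddMu (c : V) (p : PolynomialModule F V) (n m : ℕ) :
    ((bracketLambdaAddMu br c p).coeff n).coeff m =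
      ∑ k ∈ Finset.range (m + 1),
        (m - k + n).choose (m - k) • (br (p.coeff k) c).coeff (m - k + n) := by
  have h0 : ∀ (q : PolynomialModule F V) (n m : ℕ),
      ((substVar (inclLambda F V ∘ₗ PolynomialModule.lsingle F 0)
        (mulLambda F V + mulMu F V) q).coeff n).coeff m =
        (m + n).choose m • q.coeff (m + n) := by
    intro q n m
    have h := map_substVar_eq_sum (inclLambda F V ∘ₗ PolynomialModule.lsingle F 0)
      (mulLambda F V + mulMu F V) (lcoeff F m ∘ₗ lcoeff F n) q {m + n} fun k hk => by
        rw [Finset.mem_singleton] at hk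
        simp only [LinearMap.comp_apply, lcoeff_apply, coeff_mulLambda_add_mulMu_pow]
        rw [if_neg (Ne.symm hk)]
    refine h.trans ?_
    simp only [Finset.sum_singleton, LinearMap.comp_apply, lcoeff_apply,
      coeff_mulLambda_add_mulMu_pow, if_true]
  have h := map_substVar_eq_sum (substVar (inclLambda F V ∘ₗ PolynomialModule.lsingle F 0)
      (mulLambda F V + mulMu F V) ∘ₗ br.flip c) (mulLambda F V) (lcoeff F m ∘ₗ lcoeff F n) p
    (Finset.range (m + 1)) fun k hk => by
      rw [Finset.mem_range] at hk
      simp only [LinearMap.comp_apply, lcoeff_apply, coeff_mulLambda_pow]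
      rw [if_neg (by omega)]
  refine h.trans (Finset.sum_congr rfl fun k hk => ?_)
  rw [Finset.mem_range] at hk
  simp only [LinearMap.comp_apply, lcoeff_apply, coeff_mulLambda_pow]
  rw [if_pos (by omega), h0]
  rfl

theorem coeff_substSkew (del : V →ₗ[F] V) (p : PolynomialModule F V) (N k : ℕ)
    (hN : ∀ n, N ≤ n → p.coeff n = 0) :
    (substSkew del p).coeff k =
      ∑ n ∈ Finset.range N, (-1 : ℤ) ^ n • n.choose k • (del ^ (n - k)) (p.coeff n) := by
  have h := map_substVar_eq_sum (PolynomialModule.lsingle F 0)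
    (-mulVar F V - PolynomialModule.map F del) (lcoeff F k) p (Finset.range N) fun n hn => by
      rw [hN n (by simpa using hn)]
      simp
  refine h.trans (Finset.sum_congr rfl fun n _ => ?_)
  rw [lcoeff_apply, coeff_skew_pow]

/-- The `j`-th product of a `λ`-bracket: `{a_λ b} = ∑_j (λ ^ j / j!) a_(j)b`. -/
def bracketProd (j : ℕ) (a b : V) : V := j.factorial • (br a b).coeff j

theorem bracketProd_nsmul_left (j k : ℕ) (a b : V) :
    bracketProd br j (k • a) b = k • bracketProd br j a b := by
  rw [bracketProd, map_nsmul, LinearMap.smul_apply, bracketProd, smul_comm]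
  rfl

theorem bracketProd_nsmul_right (j k : ℕ) (a b : V) :
    bracketProd br j a (k • b) = k • bracketProd br j a b := by
  rw [bracketProd, map_nsmul, bracketProd, smul_comm]
  rfl

/-- The axioms of a Lie conformal algebra in terms of the `j`-th products. -/
theorem isLieConformalAlgebra_of_bracketProd [CharZero F] (del : V →ₗ[F] V)
    (hzero : ∀ a b, bracketProd br 0 (del a) b = 0)
    (hsucc : ∀ j a b, bracketProd br (j + 1) (del a) b = -((j + 1) • bracketProd br j a b))
    (hdel : ∀ j a b, del (bracketProd br j a b) =
      bracketProd br j (del a) b + bracketProd br j a (del b))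
    (hskew : ∀ a b, ∃ N, (∀ j, N ≤ j → bracketProd br j a b = 0) ∧ ∀ m, bracketProd br m b a =
      -∑ j ∈ Finset.range N, if j < m then 0 else
        (-1 : ℤ) ^ j • (((j - m).factorial : F)⁻¹ • (del ^ (j - m)) (bracketProd br j a b)))
    (hjacobi : ∀ (m n : ℕ) (a b c : V),
      bracketProd br m a (bracketProd br n b c) - bracketProd br n b (bracketProd br m a c) =
        ∑ j ∈ Finset.range (m + 1),
          m.choose j • bracketProd br (m - j + n) (bracketProd br j a b) c) :
    IsLieConformalAlgebra del br := by
  have := IsAddTorsionFree.of_isTorsionFree F V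
  have hleft : ∀ a b, br (del a) b = -mulVar F V (br a b) := by
    intro a b
    ext j
    refine nsmul_right_injective (Nat.factorial_ne_zero j) ?_
    change bracketProd br j (del a) b = j.factorial • -(mulVar F V (br a b)).coeff j
    rw [coeff_mulVar]
    rcases j with _ | j
    · simp [hzero]
    · rw [hsucc, if_neg (by omega), Nat.add_sub_cancel, Nat.factorial_succ, bracketProd, smul_neg,
        mul_smul]
  refine ⟨hleft, fun a b => ?_, fun a b => ?_, fun a b c => ?_⟩
  · ext j
    refine nsmul_right_injective (Nat.factorial_ne_zero j) ?_
    -- Right sesquilinearity follows from the left one and the fact that `∂` is a derivation of the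
    -- products.
    have h := hdel j a b
    rw [← sub_eq_iff_eq_add'] at h
    refine h.symm.trans ?_
    rw [bracketProd, bracketProd, hleft, map_nsmul, ← smul_sub]
    congr 1
    change del ((br a b).coeff j) - -(mulVar F V (br a b)).coeff j =
      (mulVar F V (br a b)).coeff j + del ((br a b).coeff j)
    abel
  · obtain ⟨N, h0, hN⟩ := hskew a b
    ext k
    refine nsmul_right_injective (Nat.factorial_ne_zero k) ?_
    change bracketProd br k b a = k.factorial • -(substSkew del (br a b)).coeff k
    rw [hN, coeff_substSkew del _ N k fun n hn =>
      nsmul_right_injective (Nat.factorial_ne_zero n) ((h0 n hn).trans (smul_zero _).symm),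
      smul_neg, Finset.smul_sum]
    congr 1
    refine Finset.sum_congr rfl fun j _ => ?_
    split_ifs with hj
    · rw [Nat.choose_eq_zero_of_lt hj, zero_smul, smul_zero, smul_zero]
    · rw [smul_comm (k.factorial)]
      congr 1
      rw [bracketProd, map_nsmul, ← mul_smul, ← Nat.cast_smul_eq_nsmul F, ← mul_smul,
        ← Nat.cast_smul_eq_nsmul F]
      congr 1
      rw [inv_mul_eq_iff_eq_mul₀ (Nat.cast_ne_zero.2 (Nat.factorial_ne_zero _)),
        ← Nat.choose_mul_factorial_mul_factorial (not_lt.1 hj)]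
      push_cast
      ring
  · refine PolynomialModule.ext (Finsupp.ext fun n => PolynomialModule.ext (Finsupp.ext fun m => ?_))
    change ((bracketLambda br a (br b c)).coeff n).coeff m =
      ((bracketLambdaAddMu br c (br a b)).coeff n).coeff m +
        ((bracketMu br b (br a c)).coeff n).coeff m
    rw [coeff_bracketLambda, coeff_bracketMu, coeff_bracketLambdaAddMu, ← sub_eq_iff_eq_add]
    -- The coefficient of `λ ^ m μ ^ n` is scaled by `m! n!` to turn both brackets into products.
    refine nsmul_right_injective
      (mul_ne_zero (Nat.factorial_ne_zero m) (Nat.factorial_ne_zero n)) ?_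
    refine Eq.trans ?_ ((hjacobi m n a b c).trans ?_)
    · rw [bracketProd.eq_1 br n, bracketProd.eq_1 br m a c, bracketProd_nsmul_right,
        bracketProd_nsmul_right, bracketProd, bracketProd, ← mul_smul, ← mul_smul,
        mul_comm n.factorial, ← smul_sub]
    · beta_reduce
      rw [Finset.smul_sum]
      refine Finset.sum_congr rfl fun j hj => ?_
      rw [Finset.mem_range] at hj
      have hj : j ≤ m := by omega
      rw [bracketProd.eq_1 br j, bracketProd_nsmul_left, bracketProd, ← mul_smul, ← mul_smul,
        ← mul_smul]
      congr 1
      -- Both sides carry the same integer: substitute the factorial formulas for `m!` and `(m - j +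
      -- n)!`.
      have h1 := Nat.choose_mul_factorial_mul_factorial hj
      have h2 := Nat.choose_mul_factorial_mul_factorial (Nat.le_add_right (m - j) n)
      rw [Nat.add_sub_cancel_left] at h2
      rw [← h1, ← h2]
      ring

end PolynomialCoefficients

/-! ### The products of the quasiclassical limit -/

namespace QuasiclassicalLimit

theorem del_pow_proj {F V : Type*} [Field F] [AddCommGroup V] [Module F⟦X⟧ V] [Module F V]
    [IsScalarTower F F⟦X⟧ V] (A : VertexAlgebra F⟦X⟧ V) (i : ℕ) (a : V) :
    (del A ^ i) (proj F a) = proj F ((A.T ^ i) a) := by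
  induction i with
  | zero => rfl
  | succ i ih => rw [pow_succ', Module.End.mul_apply, ih, del_proj, pow_succ', Module.End.mul_apply]

variable {F V : Type*} [Field F] [CharZero F] [AddCommGroup V] [Module F⟦X⟧ V]
  (A : VertexAlgebra F⟦X⟧ V)
  (hbr : ∀ a b : V, ∃ p : PolynomialModule F⟦X⟧ V,
    A.lambdaBracket a b = (PowerSeries.X : F⟦X⟧) • p)

/-- The element `a_(j)b / ħ`. -/
def divProd (j : ℕ) (a b : V) : V := j.factorial • (divBracket A hbr a b).coeff j

theorem hbar_smul_divProd (j : ℕ) (a b : V) :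
    (PowerSeries.X : F⟦X⟧) • divProd A hbr j a b = A.nProd j a b := by
  rw [divProd, smul_comm, hbar_smul_divBracket, A.coeff_lambdaBracket,
    ← Nat.cast_smul_eq_nsmul F⟦X⟧, ← mul_smul, ← map_natCast (algebraMap ℚ F⟦X⟧), ← map_mul,
    mul_inv_cancel₀ (Nat.cast_ne_zero.2 j.factorial_ne_zero), map_one, one_smul]

/-- Since `a_(j)b` lies in `ħV`, so does every mode of it applied to `c`, including those with `n <
0`. -/
theorem proj_nProd_nProd (hbr : ∀ a b : V, ∃ p : PolynomialModule F⟦X⟧ V,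
    A.lambdaBracket a b = (PowerSeries.X : F⟦X⟧) • p)
    (n : ℤ) (j : ℕ) (a b c : V) :
    proj F (A.nProd n (A.nProd j a b) c) = 0 := by
  rw [← hbar_smul_divProd A hbr, A.nProd_smul_left, proj_hbar_smul]

theorem divProd_T_zero
    (htf : ∀ v : V, (PowerSeries.X : F⟦X⟧) • v = 0 → v = 0) (a b : V) :
    divProd A hbr 0 (A.T a) b = 0 := by
  apply htf
  rw [hbar_smul_divProd]
  refine (A.Y_T a b _).trans ?_
  simp

theorem divProd_T_succ
    (htf : ∀ v : V, (PowerSeries.X : F⟦X⟧) • v = 0 → v = 0) (j : ℕ) (a b : V) :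
    divProd A hbr (j + 1) (A.T a) b = -((j + 1) • divProd A hbr j a b) := by
  apply hbar_smul_injective htf
  rw [smul_neg, smul_comm, hbar_smul_divProd, hbar_smul_divProd]
  refine (A.Y_T a b _).trans ?_
  rw [natCast_zsmul, show ((j + 1 : ℕ) : ℤ) - 1 = j by push_cast; ring]
  rfl

theorem T_divProd
    (htf : ∀ v : V, (PowerSeries.X : F⟦X⟧) • v = 0 → v = 0) (j : ℕ) (a b : V) :
    A.T (divProd A hbr j a b) = divProd A hbr j (A.T a) b + divProd A hbr j a (A.T b) := by
  apply hbar_smul_injective htf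
  rw [smul_add, ← map_smul, hbar_smul_divProd, hbar_smul_divProd, hbar_smul_divProd]
  exact A.T_derivation a b j

theorem exists_divProd_skew [IsAddTorsionFree V]
    (htf : ∀ v : V, (PowerSeries.X : F⟦X⟧) • v = 0 → v = 0) (a b : V) :
    ∃ N : ℕ, (∀ j : ℕ, N ≤ j → divProd A hbr j a b = 0) ∧ ∀ m : ℕ,
      divProd A hbr m b a = -∑ j ∈ Finset.range N, if j < m then 0 else
        (-1 : ℤ) ^ j • A.nProd (-1 - (j - m : ℕ)) (divProd A hbr j a b) A.vac := by
  obtain ⟨N, h0, hN⟩ := A.exists_nProd_skew a b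
  refine ⟨N, fun j hj => htf _ ?_, fun m => hbar_smul_injective htf ?_⟩
  · rw [hbar_smul_divProd, h0 j hj]
  · rw [hbar_smul_divProd, hN, smul_neg, Finset.smul_sum]
    congr 1
    refine Finset.sum_congr rfl fun j _ => ?_
    split_ifs
    · rw [smul_zero]
    · rw [smul_comm, ← A.nProd_smul_left, hbar_smul_divProd]

theorem divProd_jacobi [IsAddTorsionFree V]
    (htf : ∀ v : V, (PowerSeries.X : F⟦X⟧) • v = 0 → v = 0) (m n : ℕ) (a b c : V) :
    divProd A hbr m a (divProd A hbr n b c) - divProd A hbr n b (divProd A hbr m a c) =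
      ∑ j ∈ Finset.range (m + 1),
        m.choose j • divProd A hbr (m - j + n) (divProd A hbr j a b) c := by
  -- Two cancellations, as each term of the commutator formula is a double product of non-negative
  -- indices.
  apply hbar_smul_injective htf
  apply hbar_smul_injective htf
  have h := A.nProd_comm m n a b c
  simp only [smul_sub, hbar_smul_divProd, Finset.smul_sum, ← A.nProd_smul_right]
  rw [h]
  refine Finset.sum_congr rfl fun j hj => ?_
  rw [Finset.mem_range] at hj
  rw [smul_comm _ (m.choose j), hbar_smul_divProd, smul_comm _ (m.choose j), ← A.nProd_smul_left,
    hbar_smul_divProd]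
  congr 2
  omega

theorem proj_divProd_normalProd [IsAddTorsionFree V]
    (htf : ∀ v : V, (PowerSeries.X : F⟦X⟧) • v = 0 → v = 0) (m : ℕ) (a b c : V) :
    proj F (divProd A hbr m a (A.normalProd b c)) =
      proj F (A.normalProd (divProd A hbr m a b) c) +
        proj F (A.normalProd b (divProd A hbr m a c)) := by
  have h : divProd A hbr m a (A.normalProd b c) =
      A.normalProd b (divProd A hbr m a c) + ((PowerSeries.X : F⟦X⟧) •
        ∑ j ∈ Finset.range m, m.choose j • divProd A hbr (m - 1 - j) (divProd A hbr j a b) c +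
          A.normalProd (divProd A hbr m a b) c) := by
    apply hbar_smul_injective htf
    have h1 := A.nProd_comm m (-1) a b c
    -- The top term `j = m` has outer index `-1` and is the normally ordered one. For `j < m` the
    -- outer index `m - 1 - j` is non-negative, which yields a second factor `ħ`.
    rw [sub_eq_iff_eq_add', Finset.sum_range_succ, Nat.choose_self, one_smul] at h1
    simp only [smul_add, VertexAlgebra.normalProd]
    rw [← A.nProd_smul_right, ← A.nProd_smul_left _ _ (divProd A hbr m a b), hbar_smul_divProd,
      hbar_smul_divProd, hbar_smul_divProd, h1, show (m : ℤ) + -1 - m = -1 by ring]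
    congr 2
    rw [Finset.smul_sum, Finset.smul_sum]
    refine Finset.sum_congr rfl fun j hj => ?_
    rw [Finset.mem_range] at hj
    rw [smul_comm _ (m.choose j), hbar_smul_divProd, smul_comm _ (m.choose j),
      ← A.nProd_smul_left, hbar_smul_divProd]
    congr 2
    omega
  rw [h, map_add, map_add, proj_hbar_smul, zero_add, add_comm]

theorem proj_normalProd_left_comm (hbr : ∀ a b : V, ∃ p : PolynomialModule F⟦X⟧ V,
    A.lambdaBracket a b = (PowerSeries.X : F⟦X⟧) • p)
    [IsAddTorsionFree V] (a b c : V) :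
    proj F (A.normalProd a (A.normalProd b c)) = proj F (A.normalProd b (A.normalProd a c)) := by
  obtain ⟨N, -, hN⟩ := A.exists_nProd_neg_one_comm a b
  rw [← sub_eq_zero, ← map_sub]
  refine (congrArg (proj F) (hN N le_rfl (-1) c)).trans ?_
  rw [map_sum]
  refine Finset.sum_eq_zero fun j _ => ?_
  rw [map_zsmul, proj_nProd_nProd A hbr, smul_zero]

/-- Commuting left multiplications are applied to the vacuum, a right unit. -/
theorem proj_normalProd_comm (hbr : ∀ a b : V, ∃ p : PolynomialModule F⟦X⟧ V,
    A.lambdaBracket a b = (PowerSeries.X : F⟦X⟧) • p)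
    [IsAddTorsionFree V] (a b : V) :
    proj F (A.normalProd a b) = proj F (A.normalProd b a) := by
  simpa only [A.normalProd_vac] using proj_normalProd_left_comm A hbr a b A.vac

variable [Module F V] [IsScalarTower F F⟦X⟧ V]

/-- Lets each axiom of the quotient be checked on preimages in `V`, by way of `divProd`. -/
theorem bracketProd_bracket
    (htf : ∀ v : V, (PowerSeries.X : F⟦X⟧) • v = 0 → v = 0) (j : ℕ) (a b : V) :
    bracketProd (bracket A htf hbr) j (proj F a) (proj F b) = proj F (divProd A hbr j a b) := by
  rw [bracketProd, bracket_proj A htf hbr a b (divBracket A hbr a b) (hbr a b).choose_spec,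
    coeff_projPoly, divProd, map_nsmul]

theorem isLieConformalAlgebra [IsAddTorsionFree V]
    (htf : ∀ v : V, (PowerSeries.X : F⟦X⟧) • v = 0 → v = 0) :
    IsLieConformalAlgebra (del A) (bracket A htf hbr) := by
  have hsurj : Function.Surjective (proj F : V → Carrier F V) := (hbarSubmodule F V).mkQ_surjective
  refine isLieConformalAlgebra_of_bracketProd _ _ ?_ ?_ ?_ ?_ ?_
  · refine hsurj.forall₂.2 fun a b => ?_
    rw [del_proj, bracketProd_bracket, divProd_T_zero A hbr htf, map_zero]
  · refine fun j => hsurj.forall₂.2 fun a b => ?_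
    rw [del_proj, bracketProd_bracket, bracketProd_bracket, divProd_T_succ A hbr htf, map_neg,
      map_nsmul]
  · refine fun j => hsurj.forall₂.2 fun a b => ?_
    simp only [del_proj, bracketProd_bracket]
    rw [T_divProd A hbr htf, map_add]
  · refine hsurj.forall₂.2 fun a b => ?_
    obtain ⟨N, h0, hN⟩ := exists_divProd_skew A hbr htf a b
    refine ⟨N, fun j hj => ?_, fun m => ?_⟩
    · rw [bracketProd_bracket, h0 j hj, map_zero]
    · rw [bracketProd_bracket, hN, map_neg, map_sum]
      congr 1
      refine Finset.sum_congr rfl fun j _ => ?_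
      split_ifs
      · rw [map_zero]
      -- The factorial in `T ^ i v = i! v_(-1-i)|0⟩` cancels the inverse factorial required by the
      -- criterion.
      · rw [bracketProd_bracket, del_pow_proj, A.T_pow_eq, map_zsmul, map_nsmul,
          ← Nat.cast_smul_eq_nsmul F,
          inv_smul_smul₀ (Nat.cast_ne_zero.2 (Nat.factorial_ne_zero _))]
  · refine fun m n => hsurj.forall₃.2 fun a b c => ?_
    simp only [bracketProd_bracket, ← map_nsmul, ← map_sum, ← map_sub]
    rw [divProd_jacobi A hbr htf]

end QuasiclassicalLimit

end

/-! ### The Poisson vertex algebra axioms for the quotient. -/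

theorem theorem4p2 {F V : Type*} [Field F] [CharZero F] [AddCommGroup V] [Module F⟦X⟧ V]
    [Module F V] [IsScalarTower F F⟦X⟧ V] (A : VertexAlgebra F⟦X⟧ V)
    (htf : ∀ v : V, (PowerSeries.X : F⟦X⟧) • v = 0 → v = 0)
    (hbr : ∀ a b : V, ∃ p : PolynomialModule F⟦X⟧ V,
      A.lambdaBracket a b = (PowerSeries.X : F⟦X⟧) • p) :
    (quasiclassicalLimit A htf hbr).IsPoissonVertexAlgebra := by
  have := IsAddTorsionFree.of_isTorsionFree F V
  have := IsAddTorsionFree.of_isTorsionFree F (QuasiclassicalLimit.Carrier F V)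
  have hsurj : Function.Surjective (QuasiclassicalLimit.proj F : V → _) :=
    (QuasiclassicalLimit.hbarSubmodule F V).mkQ_surjective
  refine ⟨QuasiclassicalLimit.isLieConformalAlgebra A hbr htf, ⟨?_, ?_, ?_, ?_⟩, ?_⟩
  · refine hsurj.forall₂.2 fun a b => ?_
    simp only [quasiclassicalLimit, QuasiclassicalLimit.mul_proj]
    exact QuasiclassicalLimit.proj_normalProd_comm A hbr a b
  · refine hsurj.forall₃.2 fun a b c => ?_
    simp only [quasiclassicalLimit, QuasiclassicalLimit.mul_proj]
    -- Associativity in the form `(ab)c = c(ab) = a(cb) = a(bc)`.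
    rw [QuasiclassicalLimit.proj_normalProd_comm A hbr (A.normalProd a b) c,
      QuasiclassicalLimit.proj_normalProd_left_comm A hbr]
    exact QuasiclassicalLimit.proj_normalProd_congr A rfl
      (QuasiclassicalLimit.proj_normalProd_comm A hbr c b)
  · refine hsurj.forall.2 fun a => ?_
    simp only [quasiclassicalLimit, QuasiclassicalLimit.mul_proj]
    rw [A.vac_normalProd]
  · refine hsurj.forall₂.2 fun a b => ?_
    simp only [quasiclassicalLimit, QuasiclassicalLimit.mul_proj, QuasiclassicalLimit.del_proj,
      ← map_add]
    exact congrArg (QuasiclassicalLimit.proj F) (A.T_derivation a b (-1))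
  · refine hsurj.forall₃.2 fun a b c => ?_
    ext m
    refine nsmul_right_injective (Nat.factorial_ne_zero m) ?_
    have h := QuasiclassicalLimit.proj_divProd_normalProd A hbr htf m a b c
    simp only [← QuasiclassicalLimit.mul_proj, ← QuasiclassicalLimit.bracketProd_bracket A hbr htf]
      at h
    refine h.trans ?_
    rw [bracketProd, bracketProd, map_nsmul, map_nsmul, LinearMap.smul_apply, ← smul_add]
    rfl
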